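/- **Theorem (Regret of SpectralUCB).** Let $G$ be a graph on $N\ge 1$ nodes with symmetric nonnegative weight matrix $W=(w_{i,j})$, let $\mathcal L = D - W$ (with $D$ the diagonal matrix of the row sums of $W$) be its Laplacian, and let $\mathcal L = Q\Lambda_{\mathcal L}Q^{\mathsf T}$ be an eigendecomposition with $Q$ orthogonal and $\Lambda_{\mathcal L}$ diagonal with nondecreasing entries. Let $\lambda>0$ and let $\Lambda=\Lambda_{\mathcal L}+\lambda I$, with diagonal entries $\lambda=\lambda_1\le\lambda_2\le\dots\le\lambda_N$. Let $x_1,\dots,x_K\in\mathbb R^N$ be arms with $\|x_a\|_2\le 1$ (in the spectral bandit, $K=N$ and $x_v$ is the $v$-th row of $Q$). For a horizon $T\ge 1$, let the effective dimension $d$ be the largest $d\in\{1,\dots,N\}$ such that $$(d-1)\lambda_d\le \frac{T}{\log(1+T/\lambda)} .$$ In each round $t=1,\dots,T$ the learner picks an arm $I_t$ and receives $r_t=\langle x_{I_t},\alpha\rangle+\varepsilon_t$, where $\alpha\in\mathbb R^N$ is unknown and the noise is conditionally $R$-sub-Gaussian: for a filtration $(\mathcal F_t)_{t\ge0}$ such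 that $I_t$ is $\mathcal F_{t-1}$-measurable and $\varepsilon_t$ is $\mathcal F_t$-measurable, $\mathbb E[e^{\xi\varepsilon_t}\mid\mathcal F_{t-1}]\le e^{\xi^2R^2/2}$ almost surely for all $\xi\in\mathbb R$ (in particular $e^{\xi\varepsilon_t}$ is integrable), with $R\ge 0$. Write $\|v\|_M=\sqrt{v^{\mathsf T}Mv}$. Given $\delta\in(0,1)$, $R$, $C$ and $\lambda$, the algorithm SpectralUCB picks in round $t$ an arm (ties broken arbitrarily) $$I_t\in\operatorname*{arg\,max}_{a}\Big(\langle x_a,\widehat\alpha\rangle+c_t\|x_a\|_{V_t^{-1}}\Big),\qquad \widehat\alpha=\operatorname*{arg\,min}_{w\in\mathbb R^N}\Big(\sum_{s=1}^{t-1}\big(x_{I_s}^{\mathsf T}w-r_s\big)^2+\|w\|_\Lambda^2\Big),$$ $$V_t=\Lambda+\sum_{s=1}^{t-1}x_{I_s}x_{I_s}^{\mathsf T},\qquad c_t=2R\sqrt{d\log(1+t/\lambda)+2\log(1/\delta)}+C .$$ If $\|\alpha\|_\Lambda\le C$ and $x_a^{\mathsf T}\alpha\in[-1,1]$ for all $a$,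 then, with probability at least $1-\delta$, the cumulative regret $R_T=T\max_a\langle x_a,\alpha\rangle-\sum_{t=1}^T\langle x_{I_t},\alpha\rangle$ of SpectralUCB satisfies $$R_T\le\Big(4R\sqrt{d\log(1+T/\lambda)+2\log(1/\delta)}+2C+2\Big)\sqrt{4\,d\,T\log(1+T/\lambda)} .$$ -/

import Mathlib

open MeasureTheory ProbabilityTheory Matrix

noncomputable section

/-- The Laplacian `D - W` of the weighted graph on `N` nodes with weight matrix `W`. -/
def weightedLaplacian {N : ℕ} (W : Matrix (Fin N) (Fin N) ℝ) : Matrix (Fin N) (Fin N) ℝ :=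
  Matrix.diagonal (fun i => ∑ j, W i j) - W

/-- `Q diag(ℓ) Qᵀ` is an eigendecomposition of `L`: `Q` is orthogonal, and the eigenvalues `ℓ`
are listed in nondecreasing order. -/
structure IsEigendecomposition {N : ℕ} (L Q : Matrix (Fin N) (Fin N) ℝ) (ℓ : Fin N → ℝ) :
    Prop where
  orthogonal : Q ∈ Matrix.orthogonalGroup (Fin N) ℝ
  monotone : Monotone ℓ
  eq_conj : L = Q * Matrix.diagonal ℓ * Qᵀ

/-- The norm `‖v‖_M = √(vᵀ M v)` (used for positive definite `M`). -/
def matNorm {N : ℕ} (M : Matrix (Fin N) (Fin N) ℝ) (v : Fin N → ℝ) : ℝ :=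
  Real.sqrt (v ⬝ᵥ (M *ᵥ v))

/-- The effective dimension: the largest `d ∈ {1, …, N}` with
`(d - 1) lam_d ≤ T / log (1 + T / reg)`. The `d`-th entry (counted from one) of the list `lam`
is `lam i` with `d = i + 1`. -/
def effectiveDim {N : ℕ} (lam : Fin N → ℝ) (reg : ℝ) (T : ℕ) : ℕ :=
  sSup {d : ℕ | ∃ i : Fin N, d = (i : ℕ) + 1 ∧
    ((d : ℝ) - 1) * lam i ≤ (T : ℝ) / Real.log (1 + (T : ℝ) / reg)}

theorem isGreatest_effectiveDim {N : ℕ} (hN : 0 < N) (lam : Fin N → ℝ) {reg : ℝ} (hreg : 0 < reg)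
    (T : ℕ) :
    IsGreatest {d : ℕ | ∃ i : Fin N, d = (i : ℕ) + 1 ∧
      ((d : ℝ) - 1) * lam i ≤ (T : ℝ) / Real.log (1 + (T : ℝ) / reg)}
      (effectiveDim lam reg T) := by
  have hT : (0 : ℝ) ≤ (T : ℝ) / reg := by positivity
  have hlog : 0 ≤ Real.log (1 + (T : ℝ) / reg) := Real.log_nonneg (by linarith)
  have hne : {d : ℕ | ∃ i : Fin N, d = (i : ℕ) + 1 ∧
      ((d : ℝ) - 1) * lam i ≤ (T : ℝ) / Real.log (1 + (T : ℝ) / reg)}.Nonempty := by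
    refine ⟨1, ⟨0, hN⟩, rfl, ?_⟩
    simpa using div_nonneg (Nat.cast_nonneg T) hlog
  have hbdd : BddAbove {d : ℕ | ∃ i : Fin N, d = (i : ℕ) + 1 ∧
      ((d : ℝ) - 1) * lam i ≤ (T : ℝ) / Real.log (1 + (T : ℝ) / reg)} := by
    refine ⟨N, ?_⟩
    rintro d ⟨i, rfl, -⟩
    exact i.isLt
  exact ⟨Nat.sSup_mem hne hbdd, fun d hd => le_csSup hbdd hd⟩

/-- The spectrally penalized least-squares loss of `w` given the arms `I s` pulled and the rewards
`r s` received in the rounds `s = 1, …, t - 1`. -/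
def spectralLoss {N K : ℕ} (M : Matrix (Fin N) (Fin N) ℝ) (x : Fin K → Fin N → ℝ)
    (I : ℕ → Fin K) (r : ℕ → ℝ) (t : ℕ) (w : Fin N → ℝ) : ℝ :=
  (∑ s ∈ Finset.Ico 1 t, (x (I s) ⬝ᵥ w - r s) ^ 2) + matNorm M w ^ 2

/-- The regularized design matrix `V_t = M + ∑_{s < t} x_{I_s} x_{I_s}ᵀ` at the start of
round `t`. -/
def designMatrix {N K : ℕ} (M : Matrix (Fin N) (Fin N) ℝ) (x : Fin K → Fin N → ℝ)
    (I : ℕ → Fin K) (t : ℕ) : Matrix (Fin N) (Fin N) ℝ :=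
  M + ∑ s ∈ Finset.Ico 1 t, Matrix.vecMulVec (x (I s)) (x (I s))

/-- The confidence width `c_t = 2 R √(d log (1 + t / reg) + 2 log (1 / δ)) + C`. -/
def confidenceWidth (d : ℕ) (reg R C δ : ℝ) (t : ℕ) : ℝ :=
  2 * R * Real.sqrt (d * Real.log (1 + (t : ℝ) / reg) + 2 * Real.log (1 / δ)) + C

/-- The sequence of arms `I 1, …, I T` is chosen by SpectralUCB, given the rewards `r`: in every
round `t` the algorithm computes the spectrally penalized least-squares estimate `w` from the past
rounds and pulls an arm (ties being broken arbitrarily) that maximizes the upper confidence bound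
`x_aᵀ w + c_t ‖x_a‖_{V_t⁻¹}`. The penalty matrix is the diagonal matrix with entries `lam`. -/
def IsSpectralUCB {N K : ℕ} (lam : Fin N → ℝ) (reg R C δ : ℝ) (T : ℕ)
    (x : Fin K → Fin N → ℝ) (I : ℕ → Fin K) (r : ℕ → ℝ) : Prop :=
  ∀ t : ℕ, 1 ≤ t → t ≤ T →
    ∃ w : Fin N → ℝ, IsMinOn (spectralLoss (Matrix.diagonal lam) x I r t) Set.univ w ∧
      IsMaxOn (fun a : Fin K => x a ⬝ᵥ w +
        confidenceWidth (effectiveDim lam reg T) reg R C δ t *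
          matNorm (designMatrix (Matrix.diagonal lam) x I t)⁻¹ (x a)) Set.univ (I t)

/-- The `T`-round interaction in a stochastic linear bandit with arm vectors `x`, parameter `α` and
conditionally `R`-sub-Gaussian noise. The σ-algebra `ℱ t` is the information available after
round `t`: the arm of round `t + 1` depends on `ℱ t` only, and the noise of round `t + 1` is
`R`-sub-Gaussian given `ℱ t`. -/
structure IsLinearBandit {Ω : Type*} {mΩ : MeasurableSpace Ω} (μ : Measure Ω)
    (ℱ : Filtration ℕ mΩ) {N K : ℕ} (T : ℕ) (x : Fin K → Fin N → ℝ) (α : Fin N → ℝ) (R : ℝ)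
    (I : ℕ → Ω → Fin K) (ε r : ℕ → Ω → ℝ) : Prop where
  measurable_arm : ∀ t < T, Measurable[ℱ t] (I (t + 1))
  measurable_noise : ∀ t < T, Measurable[ℱ (t + 1)] (ε (t + 1))
  integrable_exp : ∀ t < T, ∀ ξ : ℝ, Integrable (fun ω => Real.exp (ξ * ε (t + 1) ω)) μ
  subGaussian : ∀ t < T, ∀ ξ : ℝ,
    μ[fun ω => Real.exp (ξ * ε (t + 1) ω) | ℱ t] ≤ᵐ[μ] fun _ => Real.exp (ξ ^ 2 * R ^ 2 / 2)
  reward_eq : ∀ t < T, ∀ ω, r (t + 1) ω = x (I (t + 1) ω) ⬝ᵥ α + ε (t + 1) ω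

/-- The cumulative (pseudo-)regret of the arms `I 1, …, I T`. -/
def cumulativeRegret {N K : ℕ} (T : ℕ) (x : Fin K → Fin N → ℝ) (α : Fin N → ℝ)
    (I : ℕ → Fin K) : ℝ :=
  T * (⨆ a, x a ⬝ᵥ α) - ∑ t ∈ Finset.Icc 1 T, x (I t) ⬝ᵥ α

end

section LinearAlgebra

variable {n : Type*} [Fintype n]

theorem dotProduct_mulVec_comm_of_isHermitian {A : Matrix n n ℝ} (hA : A.IsHermitian)
    (u v : n → ℝ) : u ⬝ᵥ (A *ᵥ v) = v ⬝ᵥ (A *ᵥ u) := by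
  have h : Aᵀ = A := by simpa [Matrix.IsHermitian] using hA
  rw [Matrix.dotProduct_mulVec, ← Matrix.mulVec_transpose, h, dotProduct_comm]

theorem dotProduct_vecMulVec_mulVec (u v w : n → ℝ) :
    u ⬝ᵥ (vecMulVec v v *ᵥ w) = (v ⬝ᵥ u) * (v ⬝ᵥ w) := by
  rw [Matrix.vecMulVec_mulVec]
  simp [dotProduct_comm, mul_comm]

theorem Matrix.PosSemidef.dotProduct_mulVec_sq_le {A : Matrix n n ℝ} (hA : A.PosSemidef)
    (u v : n → ℝ) : (u ⬝ᵥ (A *ᵥ v)) ^ 2 ≤ (u ⬝ᵥ (A *ᵥ u)) * (v ⬝ᵥ (A *ᵥ v)) := by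
  have key : ∀ s : ℝ, 0 ≤ (v ⬝ᵥ (A *ᵥ v)) * (s * s) + (2 * (u ⬝ᵥ (A *ᵥ v))) * s
      + u ⬝ᵥ (A *ᵥ u) := by
    intro s
    have h := hA.dotProduct_mulVec_nonneg (u + s • v)
    simp only [star_trivial, mulVec_add, mulVec_smul, add_dotProduct, dotProduct_add,
      smul_dotProduct, dotProduct_smul, smul_eq_mul] at h
    rw [dotProduct_mulVec_comm_of_isHermitian hA.1 v u] at h
    linarith
  have h := discrim_le_zero key
  rw [discrim] at h
  nlinarith

theorem posSemidef_vecMulVec_self (v : n → ℝ) : (vecMulVec v v).PosSemidef := by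
  simpa using posSemidef_vecMulVec_self_star v

variable [DecidableEq n]

theorem Matrix.PosDef.isUnit_det {A : Matrix n n ℝ} (hA : A.PosDef) : IsUnit A.det :=
  hA.det_pos.ne'.isUnit

theorem det_add_vecMulVec {A : Matrix n n ℝ} (hA : IsUnit A.det) (u v : n → ℝ) :
    (A + vecMulVec u v).det = A.det * (1 + v ⬝ᵥ (A⁻¹ *ᵥ u)) := by
  rw [vecMulVec_eq Unit, det_add_replicateCol_mul_replicateRow hA]
  congr 1
  simp [Matrix.det_unique, ← replicateCol_mulVec, ← mulVec_mulVec]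
  rfl

theorem quad_inv_add_vecMulVec {A : Matrix n n ℝ} (hA : A.PosDef) (x S : n → ℝ) (e : ℝ) :
    (S + e • x) ⬝ᵥ ((A + vecMulVec x x)⁻¹ *ᵥ (S + e • x)) = S ⬝ᵥ (A⁻¹ *ᵥ S) +
      (2 * (x ⬝ᵥ (A⁻¹ *ᵥ S)) * e + (x ⬝ᵥ (A⁻¹ *ᵥ x)) * e ^ 2 - (x ⬝ᵥ (A⁻¹ *ᵥ S)) ^ 2) /
        (1 + x ⬝ᵥ (A⁻¹ *ᵥ x)) := by
  have hA' : (A + vecMulVec x x).PosDef := hA.add_posSemidef (posSemidef_vecMulVec_self x)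
  have hw : 0 ≤ x ⬝ᵥ (A⁻¹ *ᵥ x) := by
    simpa using hA.inv.posSemidef.dotProduct_mulVec_nonneg x
  have hsymm := dotProduct_mulVec_comm_of_isHermitian hA.inv.1 S x
  set w := x ⬝ᵥ (A⁻¹ *ᵥ x) with hwdef
  set m := x ⬝ᵥ (A⁻¹ *ᵥ S) with hmdef
  have hw1 : 1 + w ≠ 0 := by positivity
  have hAx : ∀ y : n → ℝ, A *ᵥ (A⁻¹ *ᵥ y) = y := fun y => by
    rw [mulVec_mulVec, mul_nonsing_inv _ hA.isUnit_det, one_mulVec]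
  have hy : (A + vecMulVec x x)⁻¹ *ᵥ (S + e • x) =
      A⁻¹ *ᵥ S + ((e - m) / (1 + w)) • (A⁻¹ *ᵥ x) := by
    have h : (A + vecMulVec x x) *ᵥ (A⁻¹ *ᵥ S + ((e - m) / (1 + w)) • (A⁻¹ *ᵥ x))
        = S + e • x := by
      rw [mulVec_add, mulVec_smul, add_mulVec, add_mulVec, hAx, hAx, vecMulVec_mulVec,
        vecMulVec_mulVec, ← hmdef, ← hwdef]
      ext i
      simp
      field_simp
      ring
    rw [← h, mulVec_mulVec, nonsing_inv_mul _ hA'.isUnit_det, one_mulVec]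
  rw [hy]
  simp only [add_dotProduct, dotProduct_add, smul_dotProduct, dotProduct_smul, smul_eq_mul]
  rw [hsymm, ← hwdef, ← hmdef]
  field_simp
  ring

/-- Apply `log s ≤ s - 1` to the eigenvalues. -/
theorem Matrix.PosDef.log_det_le_trace_sub_card {A : Matrix n n ℝ} (hA : A.PosDef) :
    Real.log A.det ≤ A.trace - Fintype.card n := by
  have hdet : A.det = ∏ i, hA.1.eigenvalues i := by simpa using hA.1.det_eq_prod_eigenvalues
  have htr : A.trace = ∑ i, hA.1.eigenvalues i := by simpa using hA.1.trace_eq_sum_eigenvalues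
  rw [hdet, htr, Real.log_prod (fun i _ => (hA.eigenvalues_pos i).ne')]
  calc ∑ i, Real.log (hA.1.eigenvalues i) ≤ ∑ i, (hA.1.eigenvalues i - 1) :=
        Finset.sum_le_sum fun i _ => Real.log_le_sub_one_of_pos (hA.eigenvalues_pos i)
    _ = _ := by simp

/-- Hadamard's inequality: the determinant of a positive definite matrix is at most the product
of its diagonal entries. -/
theorem Matrix.PosDef.det_le_prod_diag {A : Matrix n n ℝ} (hA : A.PosDef) :
    A.det ≤ ∏ i, A i i := by
  have hd : ∀ i, 0 < A i i := fun i => hA.diag_pos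
  set D : Matrix n n ℝ := Matrix.diagonal fun i => (√(A i i))⁻¹ with hD
  have hDdet : D.det = ∏ i, (√(A i i))⁻¹ := det_diagonal
  have hDpos : 0 < D.det := by
    rw [hDdet]
    exact Finset.prod_pos fun i _ => inv_pos.2 (Real.sqrt_pos.2 (hd i))
  have hDH : Dᴴ = D := by simp [hD]
  have hB : (Dᴴ * A * D).PosDef := hA.conjTranspose_mul_mul_same
    (Matrix.mulVec_injective_iff_isUnit.2 ((Matrix.isUnit_iff_isUnit_det _).2 hDpos.ne'.isUnit))
  have htr : (Dᴴ * A * D).trace = Fintype.card n := by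
    have : ∀ i, (Dᴴ * A * D) i i = 1 := fun i => by
      have h := Real.mul_self_sqrt (hd i).le
      have h0 : √(A i i) ≠ 0 := (Real.sqrt_pos.2 (hd i)).ne'
      rw [hDH, hD, mul_diagonal, diagonal_mul]
      field_simp
      nlinarith
    calc (Dᴴ * A * D).trace = ∑ _i : n, (1 : ℝ) := Finset.sum_congr rfl fun i _ => this i
      _ = Fintype.card n := by simp
  have hlog := hB.log_det_le_trace_sub_card
  rw [htr, sub_self] at hlog
  have h1 : (Dᴴ * A * D).det ≤ 1 := by
    by_contra! h
    exact absurd (Real.log_pos h) (not_lt.2 hlog)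
  have hsq : D.det * D.det * ∏ i, A i i = 1 := by
    rw [hDdet, ← Finset.prod_mul_distrib, ← Finset.prod_mul_distrib]
    refine Finset.prod_eq_one fun i _ => ?_
    have h0 : √(A i i) ≠ 0 := (Real.sqrt_pos.2 (hd i)).ne'
    field_simp
    exact (Real.sq_sqrt (hd i).le).symm
  rw [det_mul, det_mul, hDH] at h1
  have : D.det * D.det * A.det ≤ D.det * D.det * ∏ i, A i i := by rw [hsq]; linarith
  exact le_of_mul_le_mul_left this (by positivity)

end LinearAlgebra

theorem dotProduct_weightedLaplacian_mulVec {N : ℕ} {W : Matrix (Fin N) (Fin N) ℝ}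
    (hW : W.IsSymm) (v : Fin N → ℝ) :
    v ⬝ᵥ (weightedLaplacian W *ᵥ v) = (∑ i, ∑ j, W i j * (v i - v j) ^ 2) / 2 := by
  have h1 : ∑ i, ∑ j, W i j * (v j) ^ 2 = ∑ i, ∑ j, W i j * (v i) ^ 2 := by
    rw [Finset.sum_comm]
    exact Finset.sum_congr rfl fun i _ => Finset.sum_congr rfl fun j _ => by rw [hW.apply]
  have h2 : ∑ i, ∑ j, W i j * (v i - v j) ^ 2 = ∑ i, ∑ j, W i j * (v i) ^ 2 +
      ∑ i, ∑ j, W i j * (v j) ^ 2 - 2 * ∑ i, ∑ j, W i j * (v i * v j) := by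
    simp only [Finset.mul_sum, ← Finset.sum_add_distrib, ← Finset.sum_sub_distrib]
    exact Finset.sum_congr rfl fun i _ => Finset.sum_congr rfl fun j _ => by ring
  have h3 : v ⬝ᵥ (weightedLaplacian W *ᵥ v) =
      ∑ i, ∑ j, W i j * (v i) ^ 2 - ∑ i, ∑ j, W i j * (v i * v j) := by
    rw [weightedLaplacian, sub_mulVec, dotProduct_sub]
    congr 1
    · simp only [dotProduct, mulVec_diagonal, Finset.sum_mul, Finset.mul_sum]
      exact Finset.sum_congr rfl fun i _ => Finset.sum_congr rfl fun j _ => by ring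
    · simp only [dotProduct, mulVec, Finset.mul_sum]
      exact Finset.sum_congr rfl fun i _ => Finset.sum_congr rfl fun j _ => by ring
  rw [h3, h2, h1]
  ring

theorem IsEigendecomposition.eigenvalue_nonneg {N : ℕ} {W Q : Matrix (Fin N) (Fin N) ℝ}
    {ℓ : Fin N → ℝ} (hW : W.IsSymm) (hW0 : ∀ i j, 0 ≤ W i j)
    (hQ : IsEigendecomposition (weightedLaplacian W) Q ℓ) (i : Fin N) : 0 ≤ ℓ i := by
  have hQQ : Qᵀ * Q = 1 := by
    simpa [star_eq_conjTranspose] using (Matrix.mem_orthogonalGroup_iff' (Fin N) ℝ).1 hQ.orthogonal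
  have h := dotProduct_weightedLaplacian_mulVec hW (Q *ᵥ Pi.single i 1)
  have h2 : (Q *ᵥ Pi.single i 1) ⬝ᵥ (weightedLaplacian W *ᵥ (Q *ᵥ Pi.single i 1)) = ℓ i := by
    rw [hQ.eq_conj, mulVec_mulVec, Matrix.mul_assoc, hQQ, Matrix.mul_one, dotProduct_mulVec,
      ← mulVec_transpose, transpose_mul, diagonal_transpose, ← mulVec_mulVec, mulVec_mulVec _ Qᵀ Q,
      hQQ, one_mulVec]
    simp
  rw [← h2, h]
  exact div_nonneg (Finset.sum_nonneg fun i _ => Finset.sum_nonneg fun j _ =>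
    mul_nonneg (hW0 i j) (sq_nonneg _)) zero_le_two

theorem mul_log_one_add_le {θ a : ℝ} (h0 : 0 ≤ θ) (h1 : θ ≤ 1) (ha : 0 ≤ a) :
    θ * Real.log (1 + a) ≤ Real.log (1 + θ * a) := by
  have h := strictConcaveOn_log_Ioi.concaveOn.2 (Set.mem_Ioi.2 (by linarith : 0 < 1 + a))
    (Set.mem_Ioi.2 one_pos) h0 (sub_nonneg.2 h1) (by ring)
  simp only [smul_eq_mul, Real.log_one, mul_zero, add_zero, mul_one] at h
  calc _ ≤ _ := h
    _ = _ := by ring_nf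

theorem sum_log_one_add_div_le_effectiveDim {N : ℕ} {lam : Fin N → ℝ} {reg : ℝ} (hreg : 0 < reg)
    (hmono : Monotone lam) (hlam : ∀ i, reg ≤ lam i) {T : ℕ} {s t : ℝ} (ht0 : 0 ≤ t) (htT : t ≤ T)
    (hT : 0 < T) (hst : s ≤ t) {τ : Fin N → ℝ} (hτ : ∀ i, 0 ≤ τ i) (hs : ∑ i, τ i ≤ s) :
    ∑ i, Real.log (1 + τ i / lam i) ≤
      2 * (effectiveDim lam reg T * Real.log (1 + t / reg)) := by
  set d := effectiveDim lam reg T with hd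
  have hpos : ∀ i, 0 < lam i := fun i => hreg.trans_le (hlam i)
  have hL : 0 ≤ Real.log (1 + t / reg) := Real.log_nonneg (by have := div_nonneg ht0 hreg.le; linarith)
  rw [← Finset.sum_filter_add_sum_filter_not Finset.univ (fun i : Fin N => (i : ℕ) < d), two_mul]
  refine add_le_add ?_ ?_
  · calc ∑ i ∈ Finset.univ.filter (fun i : Fin N => (i : ℕ) < d), Real.log (1 + τ i / lam i)
        ≤ ∑ i ∈ Finset.univ.filter (fun i : Fin N => (i : ℕ) < d), Real.log (1 + t / reg) := by
          refine Finset.sum_le_sum fun i _ => ?_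
          have h1 : 0 ≤ τ i / lam i := div_nonneg (hτ i) (hpos i).le
          refine Real.log_le_log (by linarith) ?_
          have h2 : τ i ≤ t :=
            (Finset.single_le_sum (fun j _ => hτ j) (Finset.mem_univ i)).trans (hs.trans hst)
          have := div_le_div₀ ht0 h2 hreg (hlam i)
          linarith
      _ = (Finset.univ.filter (fun i : Fin N => (i : ℕ) < d)).card * Real.log (1 + t / reg) := by
          simp
      _ ≤ d * Real.log (1 + t / reg) := by
          refine mul_le_mul_of_nonneg_right ?_ hL
          have h : ((Finset.univ.filter (fun i : Fin N => (i : ℕ) < d)).map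
              Fin.valEmbedding).card ≤ (Finset.range d).card := by
            refine Finset.card_le_card fun j hj => ?_
            simp only [Finset.mem_map, Finset.mem_filter] at hj
            obtain ⟨i, ⟨-, hi⟩, rfl⟩ := hj
            simpa using hi
          rw [Finset.card_map, Finset.card_range] at h
          exact_mod_cast h
  · by_cases hdN : d < N
    · set i₀ : Fin N := ⟨d, hdN⟩
      have hTpos : (0 : ℝ) < T := by exact_mod_cast hT
      have hlogT : 0 < Real.log (1 + (T : ℝ) / reg) :=
        Real.log_pos (by have := div_pos hTpos hreg; linarith)
      have hmax : (T : ℝ) / Real.log (1 + (T : ℝ) / reg) < d * lam i₀ := by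
        by_contra! hcon
        have hmem := (isGreatest_effectiveDim (by omega) lam hreg T).2
          (show d + 1 ∈ _ from ⟨i₀, rfl, by push_cast; simpa using hcon⟩)
        rw [← hd] at hmem
        omega
      calc ∑ i ∈ Finset.univ.filter (fun i : Fin N => ¬ (i : ℕ) < d), Real.log (1 + τ i / lam i)
          ≤ ∑ i ∈ Finset.univ.filter (fun i : Fin N => ¬ (i : ℕ) < d), τ i / lam i₀ := by
            refine Finset.sum_le_sum fun i hi => ?_
            have h1 : 0 ≤ τ i / lam i := div_nonneg (hτ i) (hpos i).le
            have h2 := Real.log_le_sub_one_of_pos (by linarith : 0 < 1 + τ i / lam i)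
            have h3 : lam i₀ ≤ lam i := hmono (by simpa [Fin.le_def, i₀] using hi)
            have h4 := div_le_div_of_nonneg_left (hτ i) (hpos i₀) h3
            linarith
        _ ≤ ∑ i, τ i / lam i₀ :=
            Finset.sum_le_sum_of_subset_of_nonneg (Finset.filter_subset _ _)
              fun i _ _ => div_nonneg (hτ i) (hpos i₀).le
        _ ≤ t / lam i₀ := by
            rw [← Finset.sum_div]
            exact div_le_div_of_nonneg_right (hs.trans hst) (hpos i₀).le
        _ ≤ d * (t / T * Real.log (1 + T / reg)) := by
            rw [div_lt_iff₀ hlogT] at hmax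
            rw [div_le_iff₀ (hpos i₀)]
            calc t = t / T * T := by field_simp
              _ ≤ t / T * (d * lam i₀ * Real.log (1 + T / reg)) :=
                mul_le_mul_of_nonneg_left hmax.le (by positivity)
              _ = _ := by ring
        _ ≤ d * Real.log (1 + t / reg) := by
            refine mul_le_mul_of_nonneg_left ?_ (Nat.cast_nonneg d)
            have h := mul_log_one_add_le (θ := t / T) (a := T / reg) (by positivity)
              ((div_le_one hTpos).2 htT) (by positivity)
            rwa [show t / (T : ℝ) * (T / reg) = t / reg by field_simp] at h
    · have : Finset.univ.filter (fun i : Fin N => ¬ (i : ℕ) < d) = ∅ := by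
        refine Finset.filter_eq_empty_iff.2 fun i _ => ?_
        have := i.isLt
        omega
      rw [this, Finset.sum_empty]
      positivity

section DesignMatrix

variable {N K : ℕ} {lam : Fin N → ℝ} (x : Fin K → Fin N → ℝ) (I : ℕ → Fin K)

theorem designMatrix_succ (M : Matrix (Fin N) (Fin N) ℝ) {t : ℕ} (ht : 1 ≤ t) :
    designMatrix M x I (t + 1) = designMatrix M x I t + vecMulVec (x (I t)) (x (I t)) := by
  rw [designMatrix, designMatrix, Finset.sum_Ico_succ_top ht, add_assoc]

theorem posDef_designMatrix {M : Matrix (Fin N) (Fin N) ℝ} (hM : M.PosDef) (t : ℕ) :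
    (designMatrix M x I t).PosDef :=
  hM.add_posSemidef (posSemidef_sum _ fun _ _ => posSemidef_vecMulVec_self _)

theorem dotProduct_designMatrix_mulVec (M : Matrix (Fin N) (Fin N) ℝ) (t : ℕ) (u v : Fin N → ℝ) :
    u ⬝ᵥ (designMatrix M x I t *ᵥ v) =
      u ⬝ᵥ (M *ᵥ v) + ∑ s ∈ Finset.Ico 1 t, (x (I s) ⬝ᵥ u) * (x (I s) ⬝ᵥ v) := by
  rw [designMatrix, add_mulVec, dotProduct_add, sum_mulVec, dotProduct_sum]
  simp_rw [dotProduct_vecMulVec_mulVec]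

theorem log_det_designMatrix_le {reg : ℝ} (hreg : 0 < reg)
    (hmono : Monotone lam) (hlam : ∀ i, reg ≤ lam i) (hx : ∀ a, x a ⬝ᵥ x a ≤ 1)
    {T : ℕ} (hT : 0 < T) {t : ℕ} (ht : 1 ≤ t) {b : ℝ} (htb : (t : ℝ) - 1 ≤ b) (hbT : b ≤ T) :
    Real.log (designMatrix (diagonal lam) x I t).det - Real.log (diagonal lam).det ≤
      2 * (effectiveDim lam reg T * Real.log (1 + b / reg)) := by
  have hpos : ∀ i, 0 < lam i := fun i => hreg.trans_le (hlam i)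
  set τ : Fin N → ℝ := fun i => ∑ s ∈ Finset.Ico 1 t, x (I s) i ^ 2 with hτ
  have hτ0 : ∀ i, 0 ≤ τ i := fun i => Finset.sum_nonneg fun s _ => sq_nonneg _
  have hV := posDef_designMatrix x I (PosDef.diagonal hpos) t
  have hdiag : ∀ i, designMatrix (diagonal lam) x I t i i = lam i + τ i := fun i => by
    simp [designMatrix, Matrix.add_apply, Matrix.sum_apply, vecMulVec_apply, hτ, sq]
  have h1 : Real.log (designMatrix (diagonal lam) x I t).det ≤ ∑ i, Real.log (lam i + τ i) := by
    have h := Real.log_le_log hV.det_pos hV.det_le_prod_diag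
    simp_rw [hdiag] at h
    rwa [Real.log_prod fun i _ => (add_pos_of_pos_of_nonneg (hpos i) (hτ0 i)).ne'] at h
  have h2 : Real.log (diagonal lam).det = ∑ i, Real.log (lam i) := by
    rw [det_diagonal, Real.log_prod fun i _ => (hpos i).ne']
  have ht1 : (1 : ℝ) ≤ t := by exact_mod_cast ht
  have hsum : ∑ i, τ i ≤ (t : ℝ) - 1 := by
    rw [hτ, Finset.sum_comm]
    calc ∑ s ∈ Finset.Ico 1 t, ∑ i, x (I s) i ^ 2 ≤ ∑ s ∈ Finset.Ico 1 t, (1 : ℝ) := by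
          refine Finset.sum_le_sum fun s _ => ?_
          simpa [dotProduct, sq] using hx (I s)
      _ = _ := by simp [Nat.cast_sub ht]
  calc _ ≤ ∑ i, Real.log (lam i + τ i) - ∑ i, Real.log (lam i) := by rw [h2]; gcongr
    _ = ∑ i, Real.log (1 + τ i / lam i) := by
        rw [← Finset.sum_sub_distrib]
        refine Finset.sum_congr rfl fun i _ => ?_
        rw [← Real.log_div (add_pos_of_pos_of_nonneg (hpos i) (hτ0 i)).ne' (hpos i).ne', add_div,
          div_self (hpos i).ne']
    _ ≤ _ := sum_log_one_add_div_le_effectiveDim hreg hmono hlam (by linarith) hbT hT htb hτ0 hsum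

/-- The elliptical potential identity. -/
theorem sum_log_one_add_quad_inv {M : Matrix (Fin N) (Fin N) ℝ} (hM : M.PosDef) (T : ℕ) :
    ∑ t ∈ Finset.Icc 1 T, Real.log (1 + x (I t) ⬝ᵥ ((designMatrix M x I t)⁻¹ *ᵥ x (I t))) =
      Real.log (designMatrix M x I (T + 1)).det - Real.log M.det := by
  induction T with
  | zero => simp [designMatrix]
  | succ T ih =>
    have hV := posDef_designMatrix x I hM (T + 1)
    have hw : 0 ≤ x (I (T + 1)) ⬝ᵥ ((designMatrix M x I (T + 1))⁻¹ *ᵥ x (I (T + 1))) := by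
      simpa using hV.inv.posSemidef.dotProduct_mulVec_nonneg (x (I (T + 1)))
    rw [Finset.sum_Icc_succ_top (by omega), ih, designMatrix_succ x I M (t := T + 1) (by omega),
      det_add_vecMulVec hV.isUnit_det, Real.log_mul hV.det_pos.ne' (by positivity)]
    ring

theorem spectralLoss_eq {M : Matrix (Fin N) (Fin N) ℝ} (hM : M.PosSemidef) (r : ℕ → ℝ) (t : ℕ)
    (w : Fin N → ℝ) : spectralLoss M x I r t w =
      w ⬝ᵥ (designMatrix M x I t *ᵥ w) - 2 * (∑ s ∈ Finset.Ico 1 t, r s • x (I s)) ⬝ᵥ w +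
        ∑ s ∈ Finset.Ico 1 t, r s ^ 2 := by
  have h0 : 0 ≤ w ⬝ᵥ (M *ᵥ w) := by simpa using hM.dotProduct_mulVec_nonneg w
  rw [spectralLoss, matNorm, Real.sq_sqrt h0, dotProduct_designMatrix_mulVec, sum_dotProduct,
    Finset.mul_sum, add_sub_assoc, add_assoc, add_comm, add_right_inj, ← Finset.sum_sub_distrib,
    ← Finset.sum_add_distrib]
  refine Finset.sum_congr rfl fun s _ => ?_
  rw [smul_dotProduct, smul_eq_mul]
  ring

/-- The normal equations of the penalized least-squares problem. -/
theorem designMatrix_mulVec_eq_of_isMinOn {M : Matrix (Fin N) (Fin N) ℝ} (hM : M.PosDef)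
    {r : ℕ → ℝ} {t : ℕ} {w : Fin N → ℝ} (hw : IsMinOn (spectralLoss M x I r t) Set.univ w) :
    designMatrix M x I t *ᵥ w = ∑ s ∈ Finset.Ico 1 t, r s • x (I s) := by
  have hV := posDef_designMatrix x I hM t
  set V := designMatrix M x I t with hVdef
  set b := ∑ s ∈ Finset.Ico 1 t, r s • x (I s) with hb
  set v := V⁻¹ *ᵥ b with hv
  have hVv : V *ᵥ v = b := by rw [hv, mulVec_mulVec, mul_nonsing_inv _ hV.isUnit_det, one_mulVec]
  have h : spectralLoss M x I r t w ≤ spectralLoss M x I r t v := hw (Set.mem_univ v)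
  rw [spectralLoss_eq x I hM.posSemidef, spectralLoss_eq x I hM.posSemidef, ← hVdef, ← hb] at h
  have hsq : (w - v) ⬝ᵥ (V *ᵥ (w - v)) ≤ 0 := by
    have h1 := dotProduct_mulVec_comm_of_isHermitian hV.1 v w
    simp only [mulVec_sub, sub_dotProduct, dotProduct_sub, h1]
    rw [hVv] at h ⊢
    rw [dotProduct_comm b w] at h
    rw [dotProduct_comm b v] at h
    linarith
  have hwv : w - v = 0 := by
    by_contra hne
    have := hV.dotProduct_mulVec_pos hne
    simp only [star_trivial] at this
    linarith
  rw [sub_eq_zero.1 hwv, hVv]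

end DesignMatrix

section Measurability

variable {Ω n : Type*} [Fintype n] [DecidableEq n] {mΩ : MeasurableSpace Ω}

theorem measurable_matrix_det {A : Ω → Matrix n n ℝ} (hA : ∀ i j, Measurable fun ω => A ω i j) :
    Measurable fun ω => (A ω).det := by
  have h : Continuous fun B : n → n → ℝ => (Matrix.of B).det :=
    Continuous.matrix_det (continuous_id (X := n → n → ℝ))
  exact h.measurable.comp
    (g := fun B : n → n → ℝ => (Matrix.of B).det) (f := fun ω => (A ω : n → n → ℝ))
    (measurable_pi_iff.2 fun i => measurable_pi_iff.2 fun j => hA i j)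

theorem measurable_matrix_adjugate_apply {A : Ω → Matrix n n ℝ}
    (hA : ∀ i j, Measurable fun ω => A ω i j) (i j : n) :
    Measurable fun ω => (A ω).adjugate i j := by
  have h : Continuous fun B : n → n → ℝ => (Matrix.of B).adjugate i j :=
    (Continuous.matrix_adjugate (continuous_id (X := n → n → ℝ))).matrix_elem i j
  exact h.measurable.comp
    (g := fun B : n → n → ℝ => (Matrix.of B).adjugate i j) (f := fun ω => (A ω : n → n → ℝ))
    (measurable_pi_iff.2 fun i => measurable_pi_iff.2 fun j => hA i j)

theorem measurable_dotProduct_inv_mulVec {A : Ω → Matrix n n ℝ}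
    (hA : ∀ i j, Measurable fun ω => A ω i j) {u v : Ω → n → ℝ} (hu : ∀ i, Measurable fun ω => u ω i)
    (hv : ∀ i, Measurable fun ω => v ω i) :
    Measurable fun ω => u ω ⬝ᵥ ((A ω)⁻¹ *ᵥ v ω) := by
  simp only [dotProduct, mulVec, Matrix.inv_def, Ring.inverse_eq_inv', Matrix.smul_apply,
    smul_eq_mul]
  refine Finset.measurable_sum _ fun i _ => (hu i).mul (Finset.measurable_sum _ fun j _ => ?_)
  exact ((measurable_matrix_det hA).inv.mul (measurable_matrix_adjugate_apply hA i j)).mul (hv j)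

end Measurability

section SubGaussian

variable {Ω : Type*} {m m0 : MeasurableSpace Ω} {μ : Measure Ω}

theorem lintegral_mul_le_of_condExp_le [IsFiniteMeasure μ] (hm : m ≤ m0) {g : Ω → ℝ} {k : ℝ}
    (hg : Measurable g) (hg0 : 0 ≤ g) (hgi : Integrable g μ) (hk : μ[g | m] ≤ᵐ[μ] fun _ => k)
    {f : Ω → ENNReal} (hf : Measurable[m] f) :
    ∫⁻ ω, f ω * ENNReal.ofReal (g ω) ∂μ ≤ ∫⁻ ω, f ω * ENNReal.ofReal k ∂μ := by
  have hle : (μ.withDensity fun ω => ENNReal.ofReal (g ω)).trim hm ≤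
      (ENNReal.ofReal k • μ).trim hm := by
    refine @Measure.le_iff _ m _ _ |>.2 fun s hs => ?_
    rw [trim_measurableSet_eq hm hs, trim_measurableSet_eq hm hs, withDensity_apply _ (hm s hs),
      ← ofReal_integral_eq_lintegral_ofReal hgi.integrableOn (ae_of_all _ hg0),
      ← setIntegral_condExp hm hgi hs, Measure.smul_apply, smul_eq_mul]
    calc ENNReal.ofReal (∫ ω in s, (μ[g | m]) ω ∂μ) ≤ ENNReal.ofReal (∫ ω in s, k ∂μ) :=
          ENNReal.ofReal_le_ofReal (integral_mono_ae integrable_condExp.integrableOn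
            (integrable_const k).integrableOn (ae_restrict_of_ae hk))
      _ = ENNReal.ofReal k * μ s := by
          rw [setIntegral_const, smul_eq_mul, ENNReal.ofReal_mul measureReal_nonneg,
            ofReal_measureReal, mul_comm]
  have hf' : Measurable f := hf.mono hm le_rfl
  calc ∫⁻ ω, f ω * ENNReal.ofReal (g ω) ∂μ
      = ∫⁻ ω, f ω ∂(μ.withDensity fun ω => ENNReal.ofReal (g ω)) := by
        rw [lintegral_withDensity_eq_lintegral_mul _ hg.ennreal_ofReal hf']
        simp [mul_comm]
    _ ≤ ∫⁻ ω, f ω ∂(ENNReal.ofReal k • μ) := by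
        rw [← lintegral_trim hm hf, ← lintegral_trim hm hf]
        exact lintegral_mono' hle le_rfl
    _ = ∫⁻ ω, f ω * ENNReal.ofReal k ∂μ := by
        rw [lintegral_smul_measure, lintegral_mul_const _ hf', smul_eq_mul, mul_comm]

variable [IsFiniteMeasure μ] (hm : m ≤ m0) {e : Ω → ℝ} {R : ℝ} (he : Measurable e)
  (hint : ∀ ξ : ℝ, Integrable (fun ω => Real.exp (ξ * e ω)) μ)
  (hsub : ∀ ξ : ℝ, μ[fun ω => Real.exp (ξ * e ω) | m] ≤ᵐ[μ] fun _ => Real.exp (ξ ^ 2 * R ^ 2 / 2))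

include hm he hint hsub

theorem lintegral_mul_exp_sub_le_of_const {f : Ω → ENNReal} (hf : Measurable[m] f) (ξ : ℝ) :
    ∫⁻ ω, f ω * ENNReal.ofReal (Real.exp (ξ * e ω - ξ ^ 2 * R ^ 2 / 2)) ∂μ ≤ ∫⁻ ω, f ω ∂μ := by
  have h := lintegral_mul_le_of_condExp_le hm (by fun_prop) (fun ω => (Real.exp_pos _).le)
    (hint ξ) (hsub ξ) (hf.mul_const (ENNReal.ofReal (Real.exp (-(ξ ^ 2 * R ^ 2 / 2)))))
  have h1 : ∀ ω, f ω * ENNReal.ofReal (Real.exp (-(ξ ^ 2 * R ^ 2 / 2))) *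
      ENNReal.ofReal (Real.exp (ξ * e ω)) =
      f ω * ENNReal.ofReal (Real.exp (ξ * e ω - ξ ^ 2 * R ^ 2 / 2)) := fun ω => by
    rw [mul_assoc, ← ENNReal.ofReal_mul (Real.exp_pos _).le, ← Real.exp_add]
    ring_nf
  have h2 : ∀ ω, f ω * ENNReal.ofReal (Real.exp (-(ξ ^ 2 * R ^ 2 / 2))) *
      ENNReal.ofReal (Real.exp (ξ ^ 2 * R ^ 2 / 2)) = f ω := fun ω => by
    rw [mul_assoc, ← ENNReal.ofReal_mul (Real.exp_pos _).le, ← Real.exp_add]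
    simp
  simpa only [h1, h2] using h

theorem lintegral_mul_exp_sub_le_of_finite_range {f : Ω → ENNReal} (hf : Measurable[m] f)
    {ξ : Ω → ℝ} (hξ : Measurable[m] ξ) (hfin : (Set.range ξ).Finite) :
    ∫⁻ ω, f ω * ENNReal.ofReal (Real.exp (ξ ω * e ω - ξ ω ^ 2 * R ^ 2 / 2)) ∂μ ≤
      ∫⁻ ω, f ω ∂μ := by
  classical
  have hsplit : ∀ (h : ℝ → Ω → ENNReal) (ω : Ω), f ω * h (ξ ω) ω =
      ∑ c ∈ hfin.toFinset, (ξ ⁻¹' {c}).indicator f ω * h c ω := fun h ω => by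
    rw [Finset.sum_eq_single_of_mem (ξ ω) (by simp)]
    · simp
    · intro c _ hc
      simp [hc.symm]
  have hind : ∀ c, Measurable[m] ((ξ ⁻¹' {c}).indicator f) := fun c =>
    hf.indicator (hξ (measurableSet_singleton c))
  calc ∫⁻ ω, f ω * ENNReal.ofReal (Real.exp (ξ ω * e ω - ξ ω ^ 2 * R ^ 2 / 2)) ∂μ
      = ∑ c ∈ hfin.toFinset, ∫⁻ ω, (ξ ⁻¹' {c}).indicator f ω *
          ENNReal.ofReal (Real.exp (c * e ω - c ^ 2 * R ^ 2 / 2)) ∂μ := by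
        rw [← lintegral_finsetSum]
        · exact lintegral_congr fun ω => hsplit
            (fun c ω => ENNReal.ofReal (Real.exp (c * e ω - c ^ 2 * R ^ 2 / 2))) ω
        · intro c _
          exact ((hind c).mono hm le_rfl).mul (by fun_prop)
    _ ≤ ∑ c ∈ hfin.toFinset, ∫⁻ ω, (ξ ⁻¹' {c}).indicator f ω ∂μ :=
        Finset.sum_le_sum fun c _ => lintegral_mul_exp_sub_le_of_const hm he hint hsub (hind c) c
    _ = ∫⁻ ω, f ω ∂μ := by
        rw [← lintegral_finsetSum _ fun c _ => (hind c).mono hm le_rfl]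
        exact lintegral_congr fun ω => by simpa using (hsplit (fun _ _ => 1) ω).symm

/-- A predictable choice of the exponent keeps the exponential supermartingale inequality. -/
theorem lintegral_mul_exp_sub_le {f : Ω → ENNReal} (hf : Measurable[m] f) {ξ : Ω → ℝ}
    (hξ : Measurable[m] ξ) :
    ∫⁻ ω, f ω * ENNReal.ofReal (Real.exp (ξ ω * e ω - ξ ω ^ 2 * R ^ 2 / 2)) ∂μ ≤
      ∫⁻ ω, f ω ∂μ := by
  have hs : StronglyMeasurable[m] ξ := hξ.stronglyMeasurable
  have hmeas : ∀ n, Measurable fun ω => hs.approx n ω := fun n =>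
    (@SimpleFunc.measurable Ω ℝ m _ (hs.approx n)).mono hm le_rfl
  have hmul : ∀ n, Measurable fun ω => f ω * ENNReal.ofReal
      (Real.exp (hs.approx n ω * e ω - hs.approx n ω ^ 2 * R ^ 2 / 2)) := fun n => by
    have := hmeas n
    exact (hf.mono hm le_rfl).mul (by fun_prop)
  have hlim : ∀ ω, Filter.liminf (fun n => f ω * ENNReal.ofReal
      (Real.exp (hs.approx n ω * e ω - hs.approx n ω ^ 2 * R ^ 2 / 2))) Filter.atTop =
      f ω * ENNReal.ofReal (Real.exp (ξ ω * e ω - ξ ω ^ 2 * R ^ 2 / 2)) := fun ω => by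
    refine Filter.Tendsto.liminf_eq ?_
    have h := hs.tendsto_approx ω
    refine ENNReal.Tendsto.const_mul (ENNReal.tendsto_ofReal ?_)
      (Or.inl (ENNReal.ofReal_pos.2 (Real.exp_pos _)).ne')
    exact (Real.continuous_exp.tendsto _).comp
      ((h.mul_const _).sub (((h.pow 2).mul_const _).div_const _))
  calc _ = ∫⁻ ω, Filter.liminf (fun n => f ω * ENNReal.ofReal
      (Real.exp (hs.approx n ω * e ω - hs.approx n ω ^ 2 * R ^ 2 / 2))) Filter.atTop ∂μ :=
        lintegral_congr fun ω => (hlim ω).symm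
    _ ≤ Filter.liminf (fun n => ∫⁻ ω, f ω * ENNReal.ofReal
      (Real.exp (hs.approx n ω * e ω - hs.approx n ω ^ 2 * R ^ 2 / 2)) ∂μ) Filter.atTop :=
        lintegral_liminf_le hmul
    _ ≤ Filter.liminf (fun _ : ℕ => ∫⁻ ω, f ω ∂μ) Filter.atTop :=
        Filter.liminf_le_liminf (Filter.Eventually.of_forall fun n =>
          lintegral_mul_exp_sub_le_of_finite_range hm he hint hsub hf
            (@SimpleFunc.measurable Ω ℝ m _ (hs.approx n)) (@SimpleFunc.finite_range Ω ℝ m (hs.approx n)))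
    _ = _ := by simp

omit hm he hint hsub

theorem lintegral_gaussianReal_exp_sub {R v : ℝ} (hR : 0 < R) (hv : 0 ≤ v) (a y : ℝ) :
    ∫⁻ z, ENNReal.ofReal (Real.exp ((a / R ^ 2 + √v / R * z) * y -
        (a / R ^ 2 + √v / R * z) ^ 2 * R ^ 2 / 2)) ∂(gaussianReal 0 1) =
      ENNReal.ofReal (Real.exp ((2 * a * y + v * y ^ 2 - a ^ 2) / (1 + v) / (2 * R ^ 2)) /
        √(1 + v)) := by
  obtain ⟨u, hu, rfl⟩ : ∃ u : ℝ, 0 ≤ u ∧ v = u ^ 2 := ⟨√v, Real.sqrt_nonneg v, (Real.sq_sqrt hv).symm⟩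
  rw [Real.sqrt_sq hu, gaussianReal_of_var_ne_zero 0 one_ne_zero,
    lintegral_withDensity_eq_lintegral_mul _ (measurable_gaussianPDF 0 1) (by fun_prop)]
  have hpos : 0 < 1 + u ^ 2 := by positivity
  set s : NNReal := ⟨(1 + u ^ 2)⁻¹, by positivity⟩ with hs
  have hs0 : s ≠ 0 := by
    rw [← NNReal.coe_ne_zero]
    exact (inv_pos.2 hpos).ne'
  have key : ∀ z, (gaussianPDF 0 1 * fun z => ENNReal.ofReal (Real.exp ((a / R ^ 2 + u / R * z) * y -
        (a / R ^ 2 + u / R * z) ^ 2 * R ^ 2 / 2))) z =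
      ENNReal.ofReal (Real.exp ((2 * a * y + u ^ 2 * y ^ 2 - a ^ 2) / (1 + u ^ 2) / (2 * R ^ 2)) /
        √(1 + u ^ 2)) * gaussianPDF (u * (y - a) / R / (1 + u ^ 2)) s z := fun z => by
    rw [Pi.mul_apply, gaussianPDF, gaussianPDF, ← ENNReal.ofReal_mul (gaussianPDFReal_nonneg _ _ _),
      ← ENNReal.ofReal_mul (by positivity)]
    congr 1
    rw [gaussianPDFReal, gaussianPDFReal]
    have hsv : (s : ℝ) = (1 + u ^ 2)⁻¹ := rfl
    have hq : √(1 + u ^ 2) ≠ 0 := (Real.sqrt_pos.2 hpos).ne'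
    have alg : ∀ p q E₁ E₂ E₃ E₄ : ℝ, q ≠ 0 → E₁ * E₂ = E₃ * E₄ →
        p * E₁ * E₂ = E₃ / q * (p * q * E₄) := fun p q E₁ E₂ E₃ E₄ hq h => by
      rw [mul_assoc, h]
      field_simp
    rw [hsv, Real.sqrt_mul (by positivity) (1 + u ^ 2)⁻¹, Real.sqrt_inv, NNReal.coe_one, mul_one,
      mul_inv, inv_inv]
    refine alg _ _ _ _ _ _ hq ?_
    rw [← Real.exp_add, ← Real.exp_add]
    congr 1
    field_simp
    ring
  rw [lintegral_congr key, lintegral_const_mul _ (measurable_gaussianPDF _ _),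
    lintegral_gaussianPDF_eq_one _ hs0, mul_one]

include hm he hint hsub

/-- The one-step supermartingale inequality of the method of mixtures. -/
theorem lintegral_mul_exp_div_sqrt_le (hR : 0 < R) {f : Ω → ENNReal} (hf : Measurable[m] f)
    {a v : Ω → ℝ} (ha : Measurable[m] a) (hv : Measurable[m] v) (hv0 : ∀ ω, 0 ≤ v ω) :
    ∫⁻ ω, f ω * ENNReal.ofReal (Real.exp ((2 * a ω * e ω + v ω * e ω ^ 2 - a ω ^ 2) /
      (1 + v ω) / (2 * R ^ 2)) / √(1 + v ω)) ∂μ ≤ ∫⁻ ω, f ω ∂μ := by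
  have ha' : Measurable a := ha.mono hm le_rfl
  have hv' : Measurable v := hv.mono hm le_rfl
  have hf' : Measurable f := hf.mono hm le_rfl
  calc _ = ∫⁻ ω, ∫⁻ z, f ω * ENNReal.ofReal (Real.exp ((a ω / R ^ 2 + √(v ω) / R * z) * e ω -
        (a ω / R ^ 2 + √(v ω) / R * z) ^ 2 * R ^ 2 / 2)) ∂(gaussianReal 0 1) ∂μ := by
        refine lintegral_congr fun ω => ?_
        rw [lintegral_const_mul _ (by fun_prop), lintegral_gaussianReal_exp_sub hR (hv0 ω)]
    _ = ∫⁻ z, ∫⁻ ω, f ω * ENNReal.ofReal (Real.exp ((a ω / R ^ 2 + √(v ω) / R * z) * e ω -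
        (a ω / R ^ 2 + √(v ω) / R * z) ^ 2 * R ^ 2 / 2)) ∂μ ∂(gaussianReal 0 1) := by
        refine lintegral_lintegral_swap (Measurable.aemeasurable ?_)
        simp only [Function.uncurry_def]
        fun_prop
    _ ≤ ∫⁻ _z : ℝ, ∫⁻ ω, f ω ∂μ ∂(gaussianReal 0 1) := by
        refine lintegral_mono fun z => lintegral_mul_exp_sub_le hm he hint hsub hf
          (ξ := fun ω => a ω / R ^ 2 + √(v ω) / R * z) ?_
        exact (ha.div_const _).add ((hv.sqrt.div_const _).mul_const _)
    _ = _ := by simp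

end SubGaussian

/-- Ville's maximal inequality on a finite horizon. -/
theorem mul_measure_exists_le_le_lintegral {Ω : Type*} {m0 : MeasurableSpace Ω} {μ : Measure Ω}
    (ℱ : Filtration ℕ m0) {T : ℕ} {Z : ℕ → Ω → ENNReal} (hZ : ∀ t ≤ T, Measurable[ℱ t] (Z t))
    (hstep : ∀ t < T, ∀ A, MeasurableSet[ℱ t] A → ∫⁻ ω in A, Z (t + 1) ω ∂μ ≤ ∫⁻ ω in A, Z t ω ∂μ)
    (c : ENNReal) : c * μ {ω | ∃ t ≤ T, c ≤ Z t ω} ≤ ∫⁻ ω, Z 0 ω ∂μ := by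
  have hB : ∀ n ≤ T, MeasurableSet[ℱ n] {ω | ∃ t ≤ n, c ≤ Z t ω} := fun n hn => by
    have : {ω | ∃ t ≤ n, c ≤ Z t ω} = ⋃ t ∈ Set.Iic n, {ω | c ≤ Z t ω} := by ext; simp
    rw [this]
    refine MeasurableSet.biUnion (Set.to_countable _) fun t ht => ?_
    have ht' : t ≤ n := ht
    have h : MeasurableSet[ℱ t] (Z t ⁻¹' Set.Ici c) := hZ t (ht'.trans hn) measurableSet_Ici
    exact ℱ.mono ht' _ h
  have main : ∀ n ≤ T, c * μ {ω | ∃ t ≤ n, c ≤ Z t ω} +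
      ∫⁻ ω in {ω | ∃ t ≤ n, c ≤ Z t ω}ᶜ, Z n ω ∂μ ≤ ∫⁻ ω, Z 0 ω ∂μ := by
    intro n
    induction n with
    | zero =>
      intro h0
      have hmeas := (ℱ.le 0) _ (hB 0 h0)
      rw [← lintegral_add_compl (μ := μ) (Z 0) hmeas]
      refine add_le_add ?_ le_rfl
      rw [← setLIntegral_const]
      refine setLIntegral_mono' hmeas fun ω hω => ?_
      obtain ⟨t, ht, h⟩ := hω
      rwa [Nat.le_zero.1 ht] at h
    | succ n ih =>
      intro hn
      refine le_trans ?_ (ih (by omega))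
      set B := {ω | ∃ t ≤ n, c ≤ Z t ω} with hBdef
      set B' := {ω | ∃ t ≤ n + 1, c ≤ Z t ω} with hBdef'
      have hBm := (ℱ.le n) _ (hB n (by omega))
      have hBm' := (ℱ.le (n + 1)) _ (hB (n + 1) hn)
      have hsub : B ⊆ B' := fun ω ⟨t, ht, h⟩ => ⟨t, by omega, h⟩
      have hge : ∀ ω ∈ B' \ B, c ≤ Z (n + 1) ω := by
        rintro ω ⟨⟨t, ht, h⟩, hnot⟩
        rcases Nat.lt_or_ge n t with h1 | h1
        · rwa [show t = n + 1 by omega] at h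
        · exact absurd ⟨t, h1, h⟩ hnot
      have hsplit : ∫⁻ ω in Bᶜ, Z (n + 1) ω ∂μ =
          ∫⁻ ω in B' \ B, Z (n + 1) ω ∂μ + ∫⁻ ω in B'ᶜ, Z (n + 1) ω ∂μ := by
        have hset : Bᶜ = B' \ B ∪ B'ᶜ := by
          ext ω
          have := @hsub ω
          simp only [Set.mem_compl_iff, Set.mem_union, Set.mem_sdiff]
          tauto
        rw [hset, ← lintegral_union hBm'.compl]
        · exact Set.disjoint_left.2 fun ω h1 h2 => h2 h1.1
      calc c * μ B' + ∫⁻ ω in B'ᶜ, Z (n + 1) ω ∂μ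
          = c * μ B + (c * μ (B' \ B) + ∫⁻ ω in B'ᶜ, Z (n + 1) ω ∂μ) := by
            rw [← add_assoc, ← mul_add, ← measure_union Set.disjoint_sdiff_right (hBm'.diff hBm),
              Set.union_sdiff_cancel hsub]
        _ ≤ c * μ B + (∫⁻ ω in B' \ B, Z (n + 1) ω ∂μ + ∫⁻ ω in B'ᶜ, Z (n + 1) ω ∂μ) := by
            gcongr
            rw [← setLIntegral_const]
            exact setLIntegral_mono' (hBm'.diff hBm) hge
        _ = c * μ B + ∫⁻ ω in Bᶜ, Z (n + 1) ω ∂μ := by rw [hsplit]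
        _ ≤ c * μ B + ∫⁻ ω in Bᶜ, Z n ω ∂μ := by
            exact add_le_add le_rfl (hstep n (by omega) _ (hB n (by omega)).compl)
  exact le_self_add.trans (main T le_rfl)

section Concentration

variable {Ω : Type*} {mΩ : MeasurableSpace Ω} {μ : Measure Ω} {ℱ : Filtration ℕ mΩ} {N K T : ℕ}
  {x : Fin K → Fin N → ℝ} {α : Fin N → ℝ} {R : ℝ} {I : ℕ → Ω → Fin K} {ε r : ℕ → Ω → ℝ}

theorem IsLinearBandit.mono (h : IsLinearBandit μ ℱ T x α R I ε r) (hR : 0 ≤ R) {R' : ℝ}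
    (hRR' : R ≤ R') : IsLinearBandit μ ℱ T x α R' I ε r where
  measurable_arm := h.measurable_arm
  measurable_noise := h.measurable_noise
  integrable_exp := h.integrable_exp
  reward_eq := h.reward_eq
  subGaussian t ht ξ := (h.subGaussian t ht ξ).trans (ae_of_all _ fun ω => by
    dsimp only
    gcongr)

theorem IsLinearBandit.measurable_arm_apply (h : IsLinearBandit μ ℱ T x α R I ε r) {t : ℕ}
    (ht : t < T) (i : Fin N) : Measurable[ℱ t] fun ω => x (I (t + 1) ω) i :=
  (measurable_of_finite fun a => x a i).comp (h.measurable_arm t ht)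

theorem IsLinearBandit.measurable_designMatrix_apply (h : IsLinearBandit μ ℱ T x α R I ε r)
    (M : Matrix (Fin N) (Fin N) ℝ) {t : ℕ} (ht : t ≤ T) (i j : Fin N) :
    Measurable[ℱ t] fun ω => designMatrix M x (fun s => I s ω) (t + 1) i j := by
  simp only [designMatrix, Matrix.add_apply, Matrix.sum_apply, vecMulVec_apply]
  refine measurable_const.add (Finset.measurable_sum _ fun s hs => ?_)
  obtain ⟨h1, h2⟩ := Finset.mem_Ico.1 hs
  obtain ⟨s, rfl⟩ := Nat.exists_eq_add_of_le' h1
  have hx := fun k => (h.measurable_arm_apply (show s < T by omega) k).mono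
    (ℱ.mono (show s ≤ t by omega)) le_rfl
  exact (hx i).mul (hx j)

theorem IsLinearBandit.measurable_noiseSum_apply (h : IsLinearBandit μ ℱ T x α R I ε r)
    {t : ℕ} (ht : t ≤ T) (i : Fin N) :
    Measurable[ℱ t] fun ω => (∑ s ∈ Finset.Ico 1 (t + 1), ε s ω • x (I s ω)) i := by
  simp only [Finset.sum_apply, Pi.smul_apply, smul_eq_mul]
  refine Finset.measurable_sum _ fun s hs => ?_
  obtain ⟨h1, h2⟩ := Finset.mem_Ico.1 hs
  obtain ⟨s, rfl⟩ := Nat.exists_eq_add_of_le' h1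
  exact ((h.measurable_noise s (by omega)).mono (ℱ.mono (by omega)) le_rfl).mul
    ((h.measurable_arm_apply (show s < T by omega) i).mono (ℱ.mono (by omega)) le_rfl)

/-- The self-normalized concentration inequality, for a positive sub-Gaussian parameter. -/
theorem IsLinearBandit.measure_exists_le_quad_le [IsProbabilityMeasure μ]
    (h : IsLinearBandit μ ℱ T x α R I ε r) (hR : 0 < R) {M : Matrix (Fin N) (Fin N) ℝ}
    (hM : M.PosDef) {δ : ℝ} (hδ : 0 < δ) :
    μ {ω | ∃ t ≤ T, R ^ 2 * (Real.log (designMatrix M x (fun s => I s ω) (t + 1)).det -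
        Real.log M.det + 2 * Real.log (1 / δ)) ≤
      (∑ s ∈ Finset.Ico 1 (t + 1), ε s ω • x (I s ω)) ⬝ᵥ
        ((designMatrix M x (fun s => I s ω) (t + 1))⁻¹ *ᵥ
          (∑ s ∈ Finset.Ico 1 (t + 1), ε s ω • x (I s ω)))} ≤ ENNReal.ofReal δ := by
  set V : ℕ → Ω → Matrix (Fin N) (Fin N) ℝ := fun t ω => designMatrix M x (fun s => I s ω) (t + 1)
    with hVdef
  set S : ℕ → Ω → Fin N → ℝ := fun t ω => ∑ s ∈ Finset.Ico 1 (t + 1), ε s ω • x (I s ω) with hSdef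
  have hV : ∀ t ω, (V t ω).PosDef := fun t ω => posDef_designMatrix x _ hM (t + 1)
  set z : ℕ → Ω → ℝ := fun t ω => Real.exp (S t ω ⬝ᵥ ((V t ω)⁻¹ *ᵥ S t ω) / (2 * R ^ 2) -
    (Real.log (V t ω).det - Real.log M.det) / 2) with hz
  have hVm : ∀ t ≤ T, ∀ i j, Measurable[ℱ t] fun ω => V t ω i j := fun t ht i j =>
    h.measurable_designMatrix_apply M ht i j
  have hSm : ∀ t ≤ T, ∀ i, Measurable[ℱ t] fun ω => S t ω i := fun t ht i =>
    h.measurable_noiseSum_apply ht i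
  have hzm : ∀ t ≤ T, Measurable[ℱ t] (z t) := fun t ht =>
    Real.measurable_exp.comp ((((measurable_dotProduct_inv_mulVec (hVm t ht) (hSm t ht)
      (hSm t ht)).div_const _).sub
      (((Real.measurable_log.comp (measurable_matrix_det (hVm t ht))).sub_const _).div_const _)))
  have hZm : ∀ t ≤ T, Measurable[ℱ t] fun ω => ENNReal.ofReal (z t ω) := fun t ht =>
    (hzm t ht).ennreal_ofReal
  have hw0 : ∀ t ω, 0 ≤ x (I (t + 1) ω) ⬝ᵥ ((V t ω)⁻¹ *ᵥ x (I (t + 1) ω)) := fun t ω => by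
    simpa using (hV t ω).inv.posSemidef.dotProduct_mulVec_nonneg (x (I (t + 1) ω))
  have hrec : ∀ t ω, z (t + 1) ω = z t ω *
      (Real.exp ((2 * (x (I (t + 1) ω) ⬝ᵥ ((V t ω)⁻¹ *ᵥ S t ω)) * ε (t + 1) ω +
        (x (I (t + 1) ω) ⬝ᵥ ((V t ω)⁻¹ *ᵥ x (I (t + 1) ω))) * ε (t + 1) ω ^ 2 -
        (x (I (t + 1) ω) ⬝ᵥ ((V t ω)⁻¹ *ᵥ S t ω)) ^ 2) /
        (1 + x (I (t + 1) ω) ⬝ᵥ ((V t ω)⁻¹ *ᵥ x (I (t + 1) ω))) / (2 * R ^ 2)) /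
        √(1 + x (I (t + 1) ω) ⬝ᵥ ((V t ω)⁻¹ *ᵥ x (I (t + 1) ω)))) := fun t ω => by
    have hS : S (t + 1) ω = S t ω + ε (t + 1) ω • x (I (t + 1) ω) := by
      simp only [hSdef]
      rw [Finset.sum_Ico_succ_top (by omega)]
    have hV1 : V (t + 1) ω = V t ω + vecMulVec (x (I (t + 1) ω)) (x (I (t + 1) ω)) :=
      designMatrix_succ x _ M (by omega)
    have hw := hw0 t ω
    simp only [hz]
    rw [hS, hV1, quad_inv_add_vecMulVec (hV t ω), det_add_vecMulVec (hV t ω).isUnit_det,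
      Real.log_mul (hV t ω).det_pos.ne' (by positivity),
      ← Real.exp_log (Real.sqrt_pos.2 (by positivity :
        0 < 1 + x (I (t + 1) ω) ⬝ᵥ ((V t ω)⁻¹ *ᵥ x (I (t + 1) ω)))), Real.log_sqrt (by positivity),
      ← Real.exp_sub, ← Real.exp_add]
    congr 1
    ring
  have hstep : ∀ t < T, ∀ A, MeasurableSet[ℱ t] A →
      ∫⁻ ω in A, ENNReal.ofReal (z (t + 1) ω) ∂μ ≤ ∫⁻ ω in A, ENNReal.ofReal (z t ω) ∂μ := by
    intro t ht A hA
    have hxm := fun i => h.measurable_arm_apply ht i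
    have hA' := ℱ.le t A hA
    have key := lintegral_mul_exp_div_sqrt_le (ℱ.le t)
      ((h.measurable_noise t ht).mono (ℱ.le _) le_rfl) (h.integrable_exp t ht)
      (h.subGaussian t ht) hR ((hZm t ht.le).indicator hA)
      (measurable_dotProduct_inv_mulVec (hVm t ht.le) hxm (hSm t ht.le))
      (measurable_dotProduct_inv_mulVec (hVm t ht.le) hxm hxm) (hw0 t)
    rw [← lintegral_indicator hA', ← lintegral_indicator hA']
    refine le_trans (le_of_eq (lintegral_congr fun ω => ?_)) key
    by_cases hω : ω ∈ A
    · rw [Set.indicator_of_mem hω, Set.indicator_of_mem hω, hrec t ω,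
        ENNReal.ofReal_mul (Real.exp_pos _).le]
    · rw [Set.indicator_of_notMem hω, Set.indicator_of_notMem hω, zero_mul]
  have hville := mul_measure_exists_le_le_lintegral (μ := μ) ℱ hZm hstep (ENNReal.ofReal (1 / δ))
  have hz0 : ∀ ω, z 0 ω = 1 := fun ω => by
    simp [hz, hSdef, hVdef, designMatrix]
  simp only [hz0, ENNReal.ofReal_one, lintegral_one, measure_univ] at hville
  have hc : ENNReal.ofReal δ * ENNReal.ofReal (1 / δ) = 1 := by
    rw [← ENNReal.ofReal_mul hδ.le, mul_one_div_cancel hδ.ne', ENNReal.ofReal_one]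
  calc _ ≤ μ {ω | ∃ t ≤ T, ENNReal.ofReal (1 / δ) ≤ ENNReal.ofReal (z t ω)} := by
        refine measure_mono fun ω hω => ?_
        obtain ⟨t, ht, hle⟩ := hω
        refine ⟨t, ht, ENNReal.ofReal_le_ofReal ?_⟩
        rw [← Real.exp_log (one_div_pos.2 hδ)]
        refine Real.exp_le_exp.2 ?_
        have h1 : (Real.log (V t ω).det - Real.log M.det + 2 * Real.log (1 / δ)) / 2 ≤
            S t ω ⬝ᵥ ((V t ω)⁻¹ *ᵥ S t ω) / (2 * R ^ 2) := by
          rw [div_le_div_iff₀ two_pos (by positivity)]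
          linarith
        linarith
    _ = ENNReal.ofReal δ * (ENNReal.ofReal (1 / δ) *
          μ {ω | ∃ t ≤ T, ENNReal.ofReal (1 / δ) ≤ ENNReal.ofReal (z t ω)}) := by
        rw [← mul_assoc, hc, one_mul]
    _ ≤ ENNReal.ofReal δ * 1 := by gcongr
    _ = ENNReal.ofReal δ := mul_one _

/-- The self-normalized concentration inequality. -/
theorem IsLinearBandit.measure_exists_lt_quad_le [IsProbabilityMeasure μ]
    (h : IsLinearBandit μ ℱ T x α R I ε r) (hR : 0 ≤ R) {M : Matrix (Fin N) (Fin N) ℝ}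
    (hM : M.PosDef) {δ : ℝ} (hδ : 0 < δ) (hδ1 : δ < 1) :
    μ {ω | ∃ t ≤ T, R ^ 2 * (Real.log (designMatrix M x (fun s => I s ω) (t + 1)).det -
        Real.log M.det + 2 * Real.log (1 / δ)) <
      (∑ s ∈ Finset.Ico 1 (t + 1), ε s ω • x (I s ω)) ⬝ᵥ
        ((designMatrix M x (fun s => I s ω) (t + 1))⁻¹ *ᵥ
          (∑ s ∈ Finset.Ico 1 (t + 1), ε s ω • x (I s ω)))} ≤ ENNReal.ofReal δ := by
  have hB : ∀ t ω, 0 ≤ Real.log (designMatrix M x (fun s => I s ω) (t + 1)).det -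
      Real.log M.det + 2 * Real.log (1 / δ) := fun t ω => by
    rw [← sum_log_one_add_quad_inv x (fun s => I s ω) hM]
    have h1 : 0 ≤ Real.log (1 / δ) := Real.log_nonneg ((one_le_div hδ).2 hδ1.le)
    refine add_nonneg (Finset.sum_nonneg fun s _ => Real.log_nonneg ?_) (by linarith)
    have := (posDef_designMatrix x (fun s => I s ω) hM s).inv.posSemidef.dotProduct_mulVec_nonneg
      (x (I s ω))
    rw [star_trivial] at this
    linarith
  have hle : ∀ n : ℕ, R ≤ R + 1 / ((n : ℝ) + 1) := fun n => le_add_of_nonneg_right (by positivity)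
  have hn := fun n : ℕ => (h.mono hR (hle n)).measure_exists_le_quad_le (by positivity) hM hδ
  set bad : ℕ → Set Ω := fun n => {ω | ∃ t ≤ T, (R + 1 / ((n : ℝ) + 1)) ^ 2 *
      (Real.log (designMatrix M x (fun s => I s ω) (t + 1)).det -
        Real.log M.det + 2 * Real.log (1 / δ)) ≤
      (∑ s ∈ Finset.Ico 1 (t + 1), ε s ω • x (I s ω)) ⬝ᵥ
        ((designMatrix M x (fun s => I s ω) (t + 1))⁻¹ *ᵥ
          (∑ s ∈ Finset.Ico 1 (t + 1), ε s ω • x (I s ω)))} with hbad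
  have hmono : Monotone bad := by
    rintro n k hnk ω ⟨t, ht, hω⟩
    refine ⟨t, ht, le_trans (mul_le_mul_of_nonneg_right ?_ (hB t ω)) hω⟩
    have : 1 / ((k : ℝ) + 1) ≤ 1 / ((n : ℝ) + 1) := Nat.one_div_le_one_div hnk
    gcongr
  calc _ ≤ μ (⋃ n, bad n) := by
        refine measure_mono ?_
        rintro ω ⟨t, ht, hω⟩
        have hlim : Filter.Tendsto (fun n : ℕ => (R + 1 / ((n : ℝ) + 1)) ^ 2 *
            (Real.log (designMatrix M x (fun s => I s ω) (t + 1)).det -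
              Real.log M.det + 2 * Real.log (1 / δ))) Filter.atTop
            (nhds ((R + 0) ^ 2 * (Real.log (designMatrix M x (fun s => I s ω) (t + 1)).det -
              Real.log M.det + 2 * Real.log (1 / δ)))) :=
          ((tendsto_one_div_add_atTop_nhds_zero_nat.const_add R).pow 2).mul_const _
        rw [add_zero] at hlim
        obtain ⟨n, hn⟩ := (hlim.eventually_lt_const hω).exists
        exact Set.mem_iUnion.2 ⟨n, t, ht, hn.le⟩
    _ = ⨆ n, μ (bad n) := hmono.measure_iUnion
    _ ≤ ENNReal.ofReal δ := iSup_le hn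

end Concentration

section Regret

variable {N K : ℕ} (x : Fin K → Fin N → ℝ) (I : ℕ → Fin K)

theorem designMatrix_mulVec (M : Matrix (Fin N) (Fin N) ℝ) (t : ℕ) (v : Fin N → ℝ) :
    designMatrix M x I t *ᵥ v = M *ᵥ v + ∑ s ∈ Finset.Ico 1 t, (x (I s) ⬝ᵥ v) • x (I s) := by
  rw [designMatrix, add_mulVec, sum_mulVec]
  congr 1
  refine Finset.sum_congr rfl fun s _ => ?_
  rw [vecMulVec_mulVec]
  ext i
  simp [mul_comm]

theorem quad_inv_designMatrix_mulVec_le {M : Matrix (Fin N) (Fin N) ℝ} (hM : M.PosDef) (t : ℕ)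
    (α : Fin N → ℝ) :
    (M *ᵥ α) ⬝ᵥ ((designMatrix M x I t)⁻¹ *ᵥ (M *ᵥ α)) ≤ α ⬝ᵥ (M *ᵥ α) := by
  have hV := posDef_designMatrix x I hM t
  set y := (designMatrix M x I t)⁻¹ *ᵥ (M *ᵥ α) with hy
  have hVy : designMatrix M x I t *ᵥ y = M *ᵥ α := by
    rw [hy, mulVec_mulVec, mul_nonsing_inv _ hV.isUnit_det, one_mulVec]
  have h1 := hM.posSemidef.dotProduct_mulVec_sq_le y α
  have h2 : y ⬝ᵥ (M *ᵥ y) ≤ y ⬝ᵥ (M *ᵥ α) := by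
    rw [← hVy, dotProduct_designMatrix_mulVec]
    exact le_add_of_nonneg_right (Finset.sum_nonneg fun s _ => mul_self_nonneg _)
  have h3 : 0 ≤ α ⬝ᵥ (M *ᵥ α) := by simpa using hM.posSemidef.dotProduct_mulVec_nonneg α
  rw [dotProduct_comm]
  by_contra! hcon
  nlinarith [mul_le_mul_of_nonneg_right h2 h3]

theorem abs_dotProduct_mulVec_le_matNorm {A : Matrix (Fin N) (Fin N) ℝ} (hA : A.PosSemidef)
    (u v : Fin N → ℝ) : |u ⬝ᵥ (A *ᵥ v)| ≤ matNorm A u * matNorm A v := by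
  have h0 : 0 ≤ u ⬝ᵥ (A *ᵥ u) := by simpa using hA.dotProduct_mulVec_nonneg u
  rw [matNorm, matNorm, ← Real.sqrt_mul h0]
  exact Real.abs_le_sqrt (hA.dotProduct_mulVec_sq_le u v)

/-- The error of the penalized least-squares estimate in a direction `y`. -/
theorem abs_dotProduct_sub_le {M : Matrix (Fin N) (Fin N) ℝ} (hM : M.PosDef) {α : Fin N → ℝ}
    {r ε : ℕ → ℝ} {t : ℕ} (hr : ∀ s ∈ Finset.Ico 1 t, r s = x (I s) ⬝ᵥ α + ε s) {w : Fin N → ℝ}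
    (hw : IsMinOn (spectralLoss M x I r t) Set.univ w) (y : Fin N → ℝ) :
    |y ⬝ᵥ w - y ⬝ᵥ α| ≤ matNorm (designMatrix M x I t)⁻¹ y *
      (matNorm (designMatrix M x I t)⁻¹ (∑ s ∈ Finset.Ico 1 t, ε s • x (I s)) + matNorm M α) := by
  have hV := posDef_designMatrix x I hM t
  set V := designMatrix M x I t with hVdef
  set S := ∑ s ∈ Finset.Ico 1 t, ε s • x (I s) with hS
  have hVw : V *ᵥ (w - α) = S - M *ᵥ α := by
    rw [mulVec_sub, designMatrix_mulVec_eq_of_isMinOn x I hM hw, hVdef, designMatrix_mulVec,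
      Finset.sum_congr rfl fun s hs => by rw [hr s hs, add_smul], Finset.sum_add_distrib]
    abel
  have hwα : w - α = V⁻¹ *ᵥ S - V⁻¹ *ᵥ (M *ᵥ α) := by
    rw [← mulVec_sub, ← hVw, mulVec_mulVec, nonsing_inv_mul _ hV.isUnit_det, one_mulVec]
  have hV' := hV.inv.posSemidef
  have hα : matNorm V⁻¹ (M *ᵥ α) ≤ matNorm M α :=
    Real.sqrt_le_sqrt (quad_inv_designMatrix_mulVec_le x I hM t α)
  rw [← dotProduct_sub, hwα, dotProduct_sub, mul_add]
  refine (abs_sub _ _).trans (add_le_add (abs_dotProduct_mulVec_le_matNorm hV' _ _) ?_)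
  exact (abs_dotProduct_mulVec_le_matNorm hV' _ _).trans
    (mul_le_mul_of_nonneg_left hα (Real.sqrt_nonneg _))

theorem min_one_sq_le_two_mul_log {u : ℝ} (hu : 0 ≤ u) :
    min 1 √u ^ 2 ≤ 2 * Real.log (1 + u) := by
  have h1 := Real.one_sub_inv_le_log_of_pos (by linarith : 0 < 1 + u)
  have h2 : min 1 u ≤ 2 * (1 - (1 + u)⁻¹) := by
    have : 1 - (1 + u)⁻¹ = u / (1 + u) := by field_simp; ring
    rw [this, ← mul_div_assoc, le_div_iff₀ (by linarith)]
    rcases le_total 1 u with h | h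
    · rw [min_eq_left h]; linarith
    · rw [min_eq_right h]; nlinarith
  have h3 : min 1 √u ^ 2 ≤ min 1 u := by
    refine le_min ?_ ?_
    · exact pow_le_one₀ (le_min zero_le_one (Real.sqrt_nonneg _)) (min_le_left _ _)
    · calc min 1 √u ^ 2 ≤ √u ^ 2 := by
            gcongr
            exact min_le_right _ _
        _ = u := Real.sq_sqrt hu
  linarith

theorem confidenceWidth_mono {d : ℕ} {reg R C δ : ℝ} (hreg : 0 < reg) (hR : 0 ≤ R) {t T : ℕ}
    (htT : t ≤ T) : confidenceWidth d reg R C δ t ≤ confidenceWidth d reg R C δ T := by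
  have : (0 : ℝ) ≤ t / reg := by positivity
  unfold confidenceWidth
  gcongr

/-- The regret bound, on the event that the noise is controlled in every round. -/
theorem cumulativeRegret_le_of_isSpectralUCB {lam : Fin N → ℝ} {reg R C δ : ℝ} {T : ℕ}
    (hreg : 0 < reg) (hmono : Monotone lam) (hlam : ∀ i, reg ≤ lam i)
    (hx : ∀ a, x a ⬝ᵥ x a ≤ 1) {α : Fin N → ℝ} (hR : 0 ≤ R) (hδ : 0 < δ) (hδ1 : δ < 1)
    (hC : matNorm (Matrix.diagonal lam) α ≤ C) (hα : ∀ a, x a ⬝ᵥ α ∈ Set.Icc (-1 : ℝ) 1)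
    {ε r : ℕ → ℝ} (hr : ∀ s, 1 ≤ s → s ≤ T → r s = x (I s) ⬝ᵥ α + ε s)
    (hUCB : IsSpectralUCB lam reg R C δ T x I r)
    (hgood : ∀ t, 1 ≤ t → t ≤ T → (∑ s ∈ Finset.Ico 1 t, ε s • x (I s)) ⬝ᵥ
        ((designMatrix (Matrix.diagonal lam) x I t)⁻¹ *ᵥ
          (∑ s ∈ Finset.Ico 1 t, ε s • x (I s))) ≤
      R ^ 2 * (Real.log (designMatrix (Matrix.diagonal lam) x I t).det -
        Real.log (Matrix.diagonal lam).det + 2 * Real.log (1 / δ))) :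
    cumulativeRegret T x α I ≤
      (4 * R * √(effectiveDim lam reg T * Real.log (1 + (T : ℝ) / reg)
            + 2 * Real.log (1 / δ)) + 2 * C + 2) *
        √(4 * effectiveDim lam reg T * T * Real.log (1 + (T : ℝ) / reg)) := by
  rcases Nat.eq_zero_or_pos T with rfl | hT
  · simp [cumulativeRegret]
  have hM : (Matrix.diagonal lam).PosDef := PosDef.diagonal fun i => hreg.trans_le (hlam i)
  set M := Matrix.diagonal lam with hMdef
  set d := effectiveDim lam reg T with hd
  set W : ℕ → ℝ := fun t => matNorm (designMatrix M x I t)⁻¹ (x (I t)) with hW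
  set c := confidenceWidth d reg R C δ T with hc
  have hC0 : 0 ≤ C := (Real.sqrt_nonneg _).trans hC
  have hcw0 : ∀ t, 0 ≤ confidenceWidth d reg R C δ t := fun t => by
    unfold confidenceWidth; positivity
  have hδlog : 0 ≤ Real.log (1 / δ) := Real.log_nonneg ((one_le_div hδ).2 hδ1.le)
  have : Nonempty (Fin K) := ⟨I 0⟩
  have hconf : ∀ t, 1 ≤ t → t ≤ T → matNorm (designMatrix M x I t)⁻¹
      (∑ s ∈ Finset.Ico 1 t, ε s • x (I s)) + matNorm M α ≤ confidenceWidth d reg R C δ t := by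
    intro t h1 h2
    refine add_le_add ?_ hC
    have hdet := log_det_designMatrix_le x I hreg hmono hlam hx hT h1 (b := t) (by linarith)
      (by exact_mod_cast h2)
    have hD : 0 ≤ d * Real.log (1 + (t : ℝ) / reg) :=
      mul_nonneg (Nat.cast_nonneg d) (Real.log_nonneg (by
        have : (0 : ℝ) ≤ t / reg := by positivity
        linarith))
    rw [matNorm, Real.sqrt_le_iff]
    refine ⟨by positivity, (hgood t h1 h2).trans ?_⟩
    rw [mul_pow, mul_pow, Real.sq_sqrt (by positivity)]
    have : R ^ 2 * (Real.log (designMatrix M x I t).det - Real.log M.det + 2 * Real.log (1 / δ)) ≤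
        R ^ 2 * (4 * (d * Real.log (1 + (t : ℝ) / reg) + 2 * Real.log (1 / δ))) := by
      refine mul_le_mul_of_nonneg_left ?_ (sq_nonneg R)
      linarith
    linarith
  have hround : ∀ t ∈ Finset.Icc 1 T, (⨆ a, x a ⬝ᵥ α) - x (I t) ⬝ᵥ α ≤
      (2 * c + 2) * min 1 (W t) := by
    intro t ht
    obtain ⟨h1, h2⟩ := Finset.mem_Icc.1 ht
    obtain ⟨w, hw, hmax⟩ := hUCB t h1 h2
    have hWt : 0 ≤ W t := Real.sqrt_nonneg _
    have hct : confidenceWidth d reg R C δ t ≤ c := confidenceWidth_mono hreg hR h2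
    have herr : ∀ a, |x a ⬝ᵥ w - x a ⬝ᵥ α| ≤
        confidenceWidth d reg R C δ t * matNorm (designMatrix M x I t)⁻¹ (x a) := fun a => by
      have h := abs_dotProduct_sub_le x I hM (α := α) (ε := ε) (fun s hs => by
        obtain ⟨h3, h4⟩ := Finset.mem_Ico.1 hs
        exact hr s h3 (by omega)) hw (x a)
      rw [mul_comm]
      exact h.trans (mul_le_mul_of_nonneg_left (hconf t h1 h2) (Real.sqrt_nonneg _))
    have hsup : (⨆ a, x a ⬝ᵥ α) ≤ x (I t) ⬝ᵥ α + 2 * c * W t := by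
      refine ciSup_le fun a => ?_
      have ha := (abs_le.1 (herr a)).1
      have hI := (abs_le.1 (herr (I t))).2
      have hm : x a ⬝ᵥ w + confidenceWidth d reg R C δ t *
          matNorm (designMatrix M x I t)⁻¹ (x a) ≤ x (I t) ⬝ᵥ w +
          confidenceWidth d reg R C δ t * W t := hmax (Set.mem_univ a)
      have hcW := mul_le_mul_of_nonneg_right hct hWt
      change _ ≤ confidenceWidth d reg R C δ t * W t at hI
      linarith
    have hsup2 : (⨆ a, x a ⬝ᵥ α) ≤ 1 := ciSup_le fun a => (hα a).2
    have hlow := (hα (I t)).1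
    have hc0 : 0 ≤ c := hcw0 T
    rcases le_total 1 (W t) with h | h
    · rw [min_eq_left h]; linarith
    · rw [min_eq_right h]; linarith
  have hquad : ∀ t, 0 ≤ x (I t) ⬝ᵥ ((designMatrix M x I t)⁻¹ *ᵥ x (I t)) := fun t => by
    simpa using (posDef_designMatrix x I hM t).inv.posSemidef.dotProduct_mulVec_nonneg (x (I t))
  have hsumsq : ∑ t ∈ Finset.Icc 1 T, min 1 (W t) ^ 2 ≤
      4 * (d * Real.log (1 + (T : ℝ) / reg)) := by
    have hdet := log_det_designMatrix_le x I hreg hmono hlam hx hT (t := T + 1) (b := T)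
      (by omega) (by push_cast; linarith) le_rfl
    rw [← sum_log_one_add_quad_inv x I hM T] at hdet
    calc ∑ t ∈ Finset.Icc 1 T, min 1 (W t) ^ 2 ≤ ∑ t ∈ Finset.Icc 1 T,
          2 * Real.log (1 + x (I t) ⬝ᵥ ((designMatrix M x I t)⁻¹ *ᵥ x (I t))) :=
          Finset.sum_le_sum fun t _ => min_one_sq_le_two_mul_log (hquad t)
      _ ≤ _ := by
          rw [← Finset.mul_sum]
          linarith
  have hsum : ∑ t ∈ Finset.Icc 1 T, min 1 (W t) ≤
      √(4 * d * T * Real.log (1 + (T : ℝ) / reg)) := by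
    refine Real.le_sqrt_of_sq_le (sq_sum_le_card_mul_sum_sq.trans ?_)
    calc ((Finset.Icc 1 T).card : ℝ) * ∑ t ∈ Finset.Icc 1 T, min 1 (W t) ^ 2
        ≤ T * (4 * (d * Real.log (1 + (T : ℝ) / reg))) := by
          rw [Nat.card_Icc, Nat.add_sub_cancel]
          gcongr
      _ = _ := by ring
  calc cumulativeRegret T x α I
      = ∑ t ∈ Finset.Icc 1 T, ((⨆ a, x a ⬝ᵥ α) - x (I t) ⬝ᵥ α) := by
        simp [cumulativeRegret, Finset.sum_sub_distrib]
    _ ≤ ∑ t ∈ Finset.Icc 1 T, (2 * c + 2) * min 1 (W t) := Finset.sum_le_sum hround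
    _ = (2 * c + 2) * ∑ t ∈ Finset.Icc 1 T, min 1 (W t) := by rw [Finset.mul_sum]
    _ ≤ (2 * c + 2) * √(4 * d * T * Real.log (1 + (T : ℝ) / reg)) :=
        mul_le_mul_of_nonneg_left hsum (by linarith [hcw0 T])
    _ = _ := by
        rw [hc, confidenceWidth]
        ring

end Regret

theorem mainTheorem2 {Ω : Type*} {mΩ : MeasurableSpace Ω} (μ : Measure Ω) [IsProbabilityMeasure μ]
    (ℱ : Filtration ℕ mΩ) {N K : ℕ} (T : ℕ)
    -- the weighted graph, and the eigendecomposition of its Laplacian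
    (W Q : Matrix (Fin N) (Fin N) ℝ) (ℓ : Fin N → ℝ)
    (hW_symm : W.IsSymm) (hW_nonneg : ∀ i j, 0 ≤ W i j)
    (hQ : IsEigendecomposition (weightedLaplacian W) Q ℓ)
    -- the spectral regularization, with diagonal entries `lam i = ℓ i + reg`
    (reg : ℝ) (hreg : 0 < reg) (lam : Fin N → ℝ) (hlam : ∀ i, lam i = ℓ i + reg)
    -- the arms; in the spectral bandit these are the rows of `Q`
    (x : Fin K → Fin N → ℝ) (hx : ∀ a, ‖WithLp.toLp 2 (x a)‖ ≤ 1)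
    (α : Fin N → ℝ) (C R δ : ℝ) (hR : 0 ≤ R) (hδ : 0 < δ) (hδ1 : δ < 1)
    (hC : matNorm (Matrix.diagonal lam) α ≤ C)
    (hα : ∀ a, x a ⬝ᵥ α ∈ Set.Icc (-1 : ℝ) 1)
    -- the interaction
    (I : ℕ → Ω → Fin K) (ε r : ℕ → Ω → ℝ)
    (hbandit : IsLinearBandit μ ℱ T x α R I ε r)
    (hUCB : ∀ ω, IsSpectralUCB lam reg R C δ T x (fun t => I t ω) (fun t => r t ω)) :
    1 - δ ≤ μ.real {ω | cumulativeRegret T x α (fun t => I t ω) ≤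
      (4 * R * Real.sqrt (effectiveDim lam reg T * Real.log (1 + (T : ℝ) / reg)
            + 2 * Real.log (1 / δ)) + 2 * C + 2) *
        Real.sqrt (4 * effectiveDim lam reg T * T * Real.log (1 + (T : ℝ) / reg))} := by
  have hℓ := hQ.eigenvalue_nonneg hW_symm hW_nonneg
  have hlam0 : ∀ i, reg ≤ lam i := fun i => by linarith [hlam i, hℓ i]
  have hmono : Monotone lam := fun i j hij => by
    rw [hlam, hlam]
    linarith [hQ.monotone hij]
  have hM : (Matrix.diagonal lam).PosDef := PosDef.diagonal fun i => hreg.trans_le (hlam0 i)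
  have hx1 : ∀ a, x a ⬝ᵥ x a ≤ 1 := fun a => by
    have h1 : ‖WithLp.toLp 2 (x a)‖ ^ 2 = x a ⬝ᵥ x a := by
      rw [EuclideanSpace.norm_sq_eq]
      simp [dotProduct, ← sq]
    rw [← h1]
    exact pow_le_one₀ (norm_nonneg _) (hx a)
  have hbad := hbandit.measure_exists_lt_quad_le hR hM hδ hδ1
  set bad : Set Ω := _
  change μ bad ≤ _ at hbad
  set good : Set Ω := _
  change 1 - δ ≤ μ.real good
  have hcover : Set.univ ⊆ good ∪ bad := by
    intro ω _
    by_cases hω : ω ∈ bad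
    · exact Or.inr hω
    · refine Or.inl (cumulativeRegret_le_of_isSpectralUCB x (fun t => I t ω) hreg hmono hlam0 hx1 hR
        hδ hδ1 hC hα (ε := fun t => ε t ω) (fun s h1 h2 => ?_) (hUCB ω) fun t h1 h2 => ?_)
      · obtain ⟨s, rfl⟩ := Nat.exists_eq_add_of_le' h1
        exact hbandit.reward_eq s (by omega) ω
      · obtain ⟨t, rfl⟩ := Nat.exists_eq_add_of_le' h1
        by_contra! hcon
        exact hω ⟨t, by omega, hcon⟩
  have h1 : 1 ≤ μ.real good + μ.real bad := by
    calc (1 : ℝ) = μ.real Set.univ := by simp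
      _ ≤ μ.real (good ∪ bad) := measureReal_mono hcover
      _ ≤ _ := measureReal_union_le _ _
  have h2 : μ.real bad ≤ δ := ENNReal.toReal_le_of_le_ofReal hδ.le hbad
  linarith
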